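/- A finite group $G$ is called exponent-critical if its exponent is not the least common multiple of the exponents of its proper non-abelian subgroups (the least common multiple of the empty family being $1$). An exponent-critical $p$-group has type $\mathcal A$ if exactly one of its maximal subgroups is abelian. Let $p$ be a prime and $m\ge 2$ an integer, and suppose that $p$ is odd or $m\ge 3$. Let $W=\langle a_0\rangle\times\langle a_1\rangle\times\cdots\times\langle a_{p-1}\rangle$ be the abelian group in which $a_0$ has order $p^m$ and $a_1,\dots,a_{p-1}$ have order $p^{m-1}$. Let $\phi$ be the automorphism of $W$ with $\phi(a_i)=a_ia_{i+1}$ for $0\le i\le p-2$ and $\phi(a_{p-1})=a_{p-1}\prod_{j=1}^{p-1}a_j^{-\binom pj}$. Let $U=W\rtimes\langle b_0\rangle$, where $b_0$ has order $p^{m-1}$ and $b_0^{-1}wb_0=\phi(w)$ for all $w\in W$, and let $D$ be the normal subgroup of $U$ generated by $a_0^{p^{m-1}}a_{p-1}^{p^{m-2}}$, which has order $p$. Then there is, up to isomorphism, a unique largest non-abelian exponent-critical $p$-group of exponent $p^m$ and type $\mathcal A$, namely $U/D$, and its order is $p^{(m-1)(p+1)}$. That is: $U/D$ is a non-abelian exponent-critical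 $p$-group of exponent $p^m$ and type $\mathcal A$ of order $p^{(m-1)(p+1)}$; and every non-abelian exponent-critical $p$-group $P$ of exponent $p^m$ and type $\mathcal A$ is isomorphic to a quotient of $U/D$, so that $|P|\le |U/D|$, and $P\cong U/D$ whenever $|P|=|U/D|$. -/

import Mathlib

namespace ExpCrit

/-- A finite group is exponent-critical if its exponent is not the least common multiple of the
exponents of its proper non-abelian subgroups (the least common multiple of the empty family
being `1`). -/
def IsExponentCritical (G : Type*) [Group G] [Finite G] : Prop :=
  Monoid.exponent G ≠
    (Set.toFinite {H : Subgroup G | H ≠ ⊤ ∧ ¬ IsMulCommutative H}).toFinset.lcm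
      fun H => Monoid.exponent H

/-- Exactly one maximal subgroup is abelian. -/
def HasUniqueAbelianMaximal (G : Type*) [Group G] : Prop :=
  ∃! M : Subgroup G, IsCoatom M ∧ IsMulCommutative M

/-- `P` is a non-abelian exponent-critical `p`-group of exponent `p ^ m` and of type `A`. -/
structure IsTypeA (p m : ℕ) (P : Type*) [Group P] [Finite P] : Prop where
  isPGroup : IsPGroup p P
  nonabelian : ¬ IsMulCommutative P
  exponentCritical : IsExponentCritical P
  exponent_eq : Monoid.exponent P = p ^ m
  typeA : HasUniqueAbelianMaximal P

section Construction

variable (p m : ℕ)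

/-- The order of the generator `a i`: it is `p ^ m` for `i = 0` and `p ^ (m - 1)` otherwise. -/
def ord (i : Fin p) : ℕ := if (i : ℕ) = 0 then p ^ m else p ^ (m - 1)

/-- The group `W`, written additively: the direct product of the cyclic groups `⟨a i⟩`,
`0 ≤ i ≤ p - 1`. -/
abbrev AddW : Type := (i : Fin p) → ZMod (ord p m i)

/-- The generator `a i` of `W`, in additive notation. -/
def a (i : Fin p) : AddW p m := Pi.single i 1

/-- The generator `a j` for a natural number `j < p` (and `0` for the other `j`, which do not
occur). -/
def aN (j : ℕ) : AddW p m := if h : j < p then a p m ⟨j, h⟩ else 0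

/-- The image of `a i` under `φ`, in additive notation: `a i + a (i + 1)` for `i ≤ p - 2`, and
`a i - ∑ j ∈ {1, …, p - 1}, (p choose j) • a j` for `i = p - 1`. -/
def phiGen (i : Fin p) : AddW p m :=
  if (i : ℕ) + 1 < p then aN p m i + aN p m (i + 1)
  else aN p m i - ∑ j ∈ Finset.Icc 1 (p - 1), p.choose j • aN p m j

theorem ord_nsmul_a (i : Fin p) : ord p m i • a p m i = 0 := by
  unfold a
  rw [← Pi.single_smul]
  simp

theorem pow_nsmul_aN (j : ℕ) : p ^ m • aN p m j = 0 := by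
  unfold aN
  split_ifs with h
  · have h1 : ord p m ⟨j, h⟩ ∣ p ^ m := by
      unfold ord
      split_ifs
      · exact dvd_rfl
      · exact pow_dvd_pow _ (Nat.sub_le _ _)
    obtain ⟨c, hc⟩ := h1
    rw [hc, mul_comm, mul_nsmul', ord_nsmul_a, nsmul_zero]
  · simp

theorem pow_pred_nsmul_aN (j : ℕ) (hj : j ≠ 0) : p ^ (m - 1) • aN p m j = 0 := by
  unfold aN
  split_ifs with h
  · have h1 : ord p m ⟨j, h⟩ = p ^ (m - 1) := by simp [ord, hj]
    rw [← h1, ord_nsmul_a]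
  · simp

theorem end_sub_apply (f g : AddMonoid.End (AddW p m)) (x : AddW p m) :
    (f - g) x = f x - g x := rfl

theorem end_mul_apply (f g : AddMonoid.End (AddW p m)) (x : AddW p m) :
    (f * g) x = f (g x) := rfl

theorem end_one_apply (x : AddW p m) : (1 : AddMonoid.End (AddW p m)) x = x := rfl

theorem end_add_apply (f g : AddMonoid.End (AddW p m)) (x : AddW p m) :
    (f + g) x = f x + g x := rfl

theorem end_sum_apply (s : Finset ℕ) (f : ℕ → AddMonoid.End (AddW p m)) (x : AddW p m) :
    (∑ j ∈ s, f j) x = ∑ j ∈ s, f j x := by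
  classical
  induction s using Finset.induction_on with
  | empty => rfl
  | insert b s hb ih => rw [Finset.sum_insert hb, Finset.sum_insert hb, end_add_apply, ih]

variable [hp : Fact p.Prime]

instance (i : Fin p) : NeZero (ord p m i) :=
  ⟨by unfold ord; split_ifs <;> exact pow_ne_zero _ hp.out.ne_zero⟩

theorem ord_nsmul_phiGen (i : Fin p) : ord p m i • phiGen p m i = 0 := by
  have h2 := hp.out.two_le
  by_cases h0 : (i : ℕ) = 0
  · have h1 : ord p m i = p ^ m := by simp [ord, h0]
    rw [h1]
    unfold phiGen
    rw [if_pos (by omega), nsmul_add, pow_nsmul_aN, pow_nsmul_aN, add_zero]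
  · have h1 : ord p m i = p ^ (m - 1) := by simp [ord, h0]
    rw [h1]
    unfold phiGen
    split_ifs
    · rw [nsmul_add, pow_pred_nsmul_aN _ _ _ h0, pow_pred_nsmul_aN _ _ _ (by omega), add_zero]
    · rw [nsmul_sub, pow_pred_nsmul_aN _ _ _ h0, Finset.smul_sum, Finset.sum_eq_zero, sub_zero]
      intro j hj
      rw [Finset.mem_Icc] at hj
      rw [smul_comm, pow_pred_nsmul_aN _ _ _ (by omega), nsmul_zero]

/-- The endomorphism `φ` of `W` with `φ (a i) = phiGen i` for all `i`. -/
noncomputable def phiHom : AddW p m →+ AddW p m :=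
  ∑ i : Fin p, (ZMod.lift (ord p m i)
    ⟨zmultiplesHom (AddW p m) (phiGen p m i), by
      simpa using ord_nsmul_phiGen p m i⟩).comp
    (Pi.evalAddMonoidHom (fun i : Fin p => ZMod (ord p m i)) i)

/-- `φ` as an element of the endomorphism ring of `W`. -/
noncomputable def phiEnd : AddMonoid.End (AddW p m) := phiHom p m

theorem phiEnd_a (i : Fin p) : phiEnd p m (a p m i) = phiGen p m i := by
  change phiHom p m (a p m i) = _
  unfold phiHom a
  rw [AddMonoidHom.finsetSum_apply, Finset.sum_eq_single i]
  · have := ZMod.lift_coe (ord p m i) ⟨zmultiplesHom (AddW p m) (phiGen p m i), by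
      simpa using ord_nsmul_phiGen p m i⟩ 1
    simpa using this
  · intro j _ hj
    simp [hj]
  · simp

/-- Two endomorphisms of `W` that agree on the generators `a i` are equal. -/
theorem hom_ext {f g : AddW p m →+ AddW p m} (h : ∀ i, f (a p m i) = g (a p m i)) : f = g := by
  refine AddMonoidHom.functions_ext (AddW p m) f g fun i x => ?_
  have hx : (Pi.single i x : AddW p m) = x.val • a p m i := by
    unfold a
    rw [← Pi.single_smul]
    simp
  rw [hx, map_nsmul, map_nsmul, h]

theorem end_ext {f g : AddMonoid.End (AddW p m)} (h : ∀ i, f (a p m i) = g (a p m i)) :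
    f = g := hom_ext p m h

theorem phiEnd_aN_of_lt (i : ℕ) (hi : i + 1 < p) :
    (phiEnd p m - 1) (aN p m i) = aN p m (i + 1) := by
  have h1 : aN p m i = a p m ⟨i, by omega⟩ := by simp [aN, show i < p by omega]
  have h2 := phiEnd_a p m ⟨i, by omega⟩
  rw [← h1] at h2
  rw [end_sub_apply, h2]
  simp [phiGen, hi]

theorem phiEnd_aN_last : (phiEnd p m - 1) (aN p m (p - 1)) =
    - ∑ j ∈ Finset.Icc 1 (p - 1), p.choose j • aN p m j := by
  have h0 := hp.out.two_le
  have h1 : aN p m (p - 1) = a p m ⟨p - 1, by omega⟩ := by simp [aN, show p - 1 < p by omega]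
  have h2 := phiEnd_a p m ⟨p - 1, by omega⟩
  rw [← h1] at h2
  rw [end_sub_apply, h2]
  simp [phiGen, show ¬ (p - 1 + 1 < p) by omega]

theorem pow_aN_zero (i : ℕ) (hi : i < p) :
    ((phiEnd p m - 1) ^ i) (aN p m 0) = aN p m i := by
  induction i with
  | zero => simp
  | succ k ih =>
    rw [pow_succ', end_mul_apply, ih (by omega), phiEnd_aN_of_lt _ _ _ hi]

theorem phiEnd_pow : phiEnd p m ^ p = 1 := by
  have h2 := hp.out.two_le
  have key : (phiEnd p m ^ p) (aN p m 0) = aN p m 0 := by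
    have h : phiEnd p m = (phiEnd p m - 1) + 1 := by abel
    have hN : ((phiEnd p m - 1) ^ p) (aN p m 0) =
        - ∑ j ∈ Finset.Icc 1 (p - 1), p.choose j • aN p m j := by
      rw [show (phiEnd p m - 1) ^ p = (phiEnd p m - 1) * (phiEnd p m - 1) ^ (p - 1) by
        rw [← pow_succ']; congr 1; omega, end_mul_apply,
        pow_aN_zero _ _ _ (by omega), phiEnd_aN_last]
    have hsum : ∑ j ∈ Finset.range p, p.choose j • aN p m j =
        aN p m 0 + ∑ j ∈ Finset.Icc 1 (p - 1), p.choose j • aN p m j := by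
      have : Finset.range p = insert 0 (Finset.Icc 1 (p - 1)) := by
        ext x; simp only [Finset.mem_range, Finset.mem_insert, Finset.mem_Icc]; omega
      rw [this, Finset.sum_insert (by simp)]
      simp
    conv_lhs => rw [h, (Commute.one_right (phiEnd p m - 1)).add_pow]
    rw [end_sum_apply, Finset.sum_range_succ]
    have hterm : ∀ j ∈ Finset.range p,
        ((phiEnd p m - 1) ^ j * 1 ^ (p - j) * (p.choose j : AddMonoid.End (AddW p m)))
          (aN p m 0) = p.choose j • aN p m j := by
      intro j hj
      rw [one_pow, mul_one, end_mul_apply, AddMonoid.End.natCast_apply, map_nsmul,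
        pow_aN_zero _ _ _ (Finset.mem_range.1 hj)]
    rw [Finset.sum_congr rfl hterm, hsum]
    simp [hN]
  refine end_ext p m fun i => ?_
  have hi : a p m i = ((phiEnd p m - 1) ^ (i : ℕ)) (aN p m 0) := by
    rw [pow_aN_zero _ _ _ i.2]; simp [aN]
  have hc : Commute (phiEnd p m ^ p) ((phiEnd p m - 1) ^ (i : ℕ)) :=
    (Commute.sub_right (Commute.refl _) (Commute.one_right _)).pow_pow _ _
  rw [hi, ← end_mul_apply, hc.eq, end_mul_apply, key]
  rfl

/-- The group `W`, written multiplicatively. -/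
abbrev W : Type := Multiplicative (AddW p m)

/-- `φ` as an automorphism of `W`. -/
noncomputable def phi : MulAut (W p m) :=
  AddEquiv.toMultiplicative
    (AddMonoidHom.toAddEquiv (phiEnd p m) (phiEnd p m ^ (p - 1))
      (by
        have h : phiEnd p m ^ (p - 1) * phiEnd p m = 1 := by
          rw [← pow_succ, Nat.sub_add_cancel hp.out.one_le, phiEnd_pow]
        exact h)
      (by
        have h : phiEnd p m * phiEnd p m ^ (p - 1) = 1 := by
          rw [← pow_succ', Nat.sub_add_cancel hp.out.one_le, phiEnd_pow]
        exact h))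

theorem phi_ofAdd (x : AddW p m) :
    phi p m (Multiplicative.ofAdd x) = Multiplicative.ofAdd (phiEnd p m x) := rfl

theorem phi_pow_apply (k : ℕ) (x : AddW p m) :
    (phi p m ^ k) (Multiplicative.ofAdd x) = Multiplicative.ofAdd ((phiEnd p m ^ k) x) := by
  induction k with
  | zero => rfl
  | succ k ih => rw [pow_succ', pow_succ', MulAut.mul_apply, ih, phi_ofAdd]; rfl

theorem phi_pow : phi p m ^ p ^ (m - 1) = 1 := by
  rcases Nat.eq_zero_or_pos (m - 1) with h | h
  · -- here every `a j` with `j ≠ 0` is trivial, so that `φ` is the identity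
    have hz : ∀ j, j ≠ 0 → aN p m j = 0 := fun j hj => by
      have := pow_pred_nsmul_aN p m j hj
      rwa [h, pow_zero, one_nsmul] at this
    have h1 : phiEnd p m = 1 := by
      refine end_ext p m fun i => ?_
      rw [phiEnd_a]
      have hi : aN p m i = a p m i := by simp [aN]
      unfold phiGen
      split_ifs
      · rw [hz _ (Nat.succ_ne_zero _), add_zero, hi]; rfl
      · rw [Finset.sum_eq_zero, sub_zero, hi]
        · rfl
        · intro j hj
          rw [hz j (by rw [Finset.mem_Icc] at hj; omega), nsmul_zero]
    ext1 x
    rw [← ofAdd_toAdd x, phi_pow_apply, h1, one_pow]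
    rfl
  · obtain ⟨c, hc⟩ := dvd_pow_self p h.ne'
    ext1 x
    rw [← ofAdd_toAdd x, phi_pow_apply, hc, pow_mul, phiEnd_pow, one_pow]
    rfl

/-- The cyclic group `⟨b₀⟩` of order `p ^ (m - 1)`. -/
abbrev B : Type := Multiplicative (ZMod (p ^ (m - 1)))

/-- The action of `⟨b₀⟩` on `W` for which the generator `b₀` acts as `φ⁻¹`. In the semidirect
product this means `b₀ * w * b₀⁻¹ = φ⁻¹ w`, that is, `b₀⁻¹ * w * b₀ = φ w`. -/
noncomputable def act : B p m →* MulAut (W p m) :=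
  AddMonoidHom.toMultiplicativeLeft
    (ZMod.lift (p ^ (m - 1))
      ⟨zmultiplesHom (Additive (MulAut (W p m))) (Additive.ofMul (phi p m)⁻¹), by
        have h : ((phi p m)⁻¹) ^ p ^ (m - 1) = 1 := by rw [inv_pow, phi_pow, inv_one]
        rw [zmultiplesHom_apply, natCast_zsmul, ← ofMul_pow, h, ofMul_one]⟩)

theorem act_gen : act p m (Multiplicative.ofAdd 1) = (phi p m)⁻¹ := by
  have := ZMod.lift_coe (p ^ (m - 1))
      ⟨zmultiplesHom (Additive (MulAut (W p m))) (Additive.ofMul (phi p m)⁻¹), by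
        have h : ((phi p m)⁻¹) ^ p ^ (m - 1) = 1 := by rw [inv_pow, phi_pow, inv_one]
        rw [zmultiplesHom_apply, natCast_zsmul, ← ofMul_pow, h, ofMul_one]⟩ 1
  simp only [Int.cast_one, zmultiplesHom_apply, one_smul] at this
  exact this

/-- The semidirect product `U = W ⋊ ⟨b₀⟩`. -/
abbrev U : Type := W p m ⋊[act p m] B p m

instance : Finite (U p m) :=
  haveI : NeZero (p ^ (m - 1)) := ⟨pow_ne_zero _ hp.out.ne_zero⟩
  haveI : Finite (B p m) := inferInstanceAs (Finite (ZMod (p ^ (m - 1))))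
  haveI : Finite (W p m) := inferInstanceAs (Finite (AddW p m))
  Finite.of_equiv _ SemidirectProduct.equivProd.symm

/-- The element `a j` of `U` (for `j < p`). -/
noncomputable def aU (j : ℕ) : U p m := SemidirectProduct.inl (Multiplicative.ofAdd (aN p m j))

/-- The element `b₀` of `U`. -/
noncomputable def bU : U p m := SemidirectProduct.inr (Multiplicative.ofAdd 1)

/-- The defining relation `b₀⁻¹ * w * b₀ = φ w` for `w ∈ W`. -/
theorem bU_inv_mul_mul (w : W p m) :
    (bU p m)⁻¹ * SemidirectProduct.inl w * bU p m = SemidirectProduct.inl (phi p m w) := by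
  have h := SemidirectProduct.inl_aut_inv (φ := act p m) (Multiplicative.ofAdd 1) w
  rw [act_gen, inv_inv] at h
  rw [h]
  simp [bU]

/-- The generator `a₀ ^ (p ^ (m - 1)) * a_{p - 1} ^ (p ^ (m - 2))` of `D`. -/
noncomputable def dU : U p m := aU p m 0 ^ p ^ (m - 1) * aU p m (p - 1) ^ p ^ (m - 2)

theorem nsmul_eq_zero_of_sum : p ^ (m - 2) •
    (- ∑ j ∈ Finset.Icc 1 (p - 1), p.choose j • aN p m j) = 0 := by
  rw [smul_neg, Finset.smul_sum, Finset.sum_eq_zero, neg_zero]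
  intro j hj
  rw [Finset.mem_Icc] at hj
  obtain ⟨c, hc⟩ := hp.out.dvd_choose_self (k := j) (by omega) (by omega)
  obtain ⟨d, hd⟩ : p ^ (m - 1) ∣ p ^ (m - 2) * p := by
    rw [← pow_succ]; exact pow_dvd_pow _ (by omega)
  rw [smul_smul, hc, ← mul_assoc, hd, mul_assoc, mul_comm, mul_smul,
    pow_pred_nsmul_aN _ _ _ (by omega), smul_zero]

theorem phiEnd_d : phiEnd p m (p ^ (m - 1) • aN p m 0 + p ^ (m - 2) • aN p m (p - 1)) =
    p ^ (m - 1) • aN p m 0 + p ^ (m - 2) • aN p m (p - 1) := by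
  have h2 := hp.out.two_le
  have h0 : (phiEnd p m - 1) (p ^ (m - 1) • aN p m 0 + p ^ (m - 2) • aN p m (p - 1)) = 0 := by
    rw [map_add, map_nsmul, map_nsmul, phiEnd_aN_of_lt _ _ _ (by omega), phiEnd_aN_last,
      pow_pred_nsmul_aN _ _ _ (by omega), zero_add, nsmul_eq_zero_of_sum]
  rw [end_sub_apply] at h0
  exact sub_eq_zero.1 h0

theorem dU_eq : dU p m = SemidirectProduct.inl (Multiplicative.ofAdd
    (p ^ (m - 1) • aN p m 0 + p ^ (m - 2) • aN p m (p - 1))) := by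
  rw [dU, aU, aU, ← MonoidHom.map_pow, ← MonoidHom.map_pow, ← MonoidHom.map_mul]
  rfl

theorem act_fix (w : W p m) (hw : phi p m w = w) (g : B p m) : act p m g w = w := by
  have hg : g = (Multiplicative.ofAdd 1) ^ (ZMod.cast (Multiplicative.toAdd g) : ℤ) := by
    apply Multiplicative.toAdd.injective
    simp
  have hmem : (phi p m)⁻¹ ∈ MulAction.stabilizer (MulAut (W p m)) w :=
    inv_mem (show phi p m ∈ MulAction.stabilizer (MulAut (W p m)) w from hw)
  rw [hg, map_zpow, act_gen]
  exact zpow_mem hmem _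

theorem dU_central (u : U p m) : u * dU p m = dU p m * u := by
  rw [dU_eq]
  have hw := act_fix p m (Multiplicative.ofAdd
    (p ^ (m - 1) • aN p m 0 + p ^ (m - 2) • aN p m (p - 1)))
    (by rw [phi_ofAdd, phiEnd_d]) u.right
  ext1
  · rw [SemidirectProduct.mul_left, SemidirectProduct.mul_left, SemidirectProduct.left_inl,
      SemidirectProduct.right_inl, hw, map_one, MulAut.one_apply, mul_comm]
  · simp

/-- The subgroup `D` of `U`. -/
noncomputable def D : Subgroup (U p m) := Subgroup.zpowers (dU p m)

instance : (D p m).Normal where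
  conj_mem n hn g := by
    have h : Commute g n := by
      obtain ⟨k, rfl⟩ := Subgroup.mem_zpowers_iff.1 hn
      exact Commute.zpow_right (show Commute g (dU p m) from dU_central p m g) k
    rwa [h.eq, mul_inv_cancel_right]

end Construction

end ExpCrit

/-!
In a group `P` of type `A` with abelian maximal subgroup `A`, criticality says that every other
maximal subgroup is killed by `p ^ (m - 1)`. Hence so are all elements outside `A` and, since any
`b ∉ A` lies in another maximal subgroup, which is normal, all commutators with `b`. An element `x`
of order `p ^ m` therefore lies in `A`, and `x`, `b` generate `P`, because no maximal subgroup
contains both.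

Modulo `⟨dU⟩ = D`, the group `U` is universal for these relations. The automorphism `φ` has order
`p`, and with `N = 1 + φ + ⋯ + φ ^ (p - 1)` one has, for `w ∈ W`,
`(b₀ w) ^ p ^ (m - 1) = N(w) ^ p ^ (m - 2)`; for `w = a₀` this is the generator of `D`. So `U / D`
maps onto `P` by `b₀ ↦ b`, `a₀ ↦ x`.

Conversely `W = ⟨a₀⟩ (φ - 1)(W)` and `N` kills `(φ - 1)(W)`, so every `(b₀ w) ^ p ^ (m - 1)` lies in
`D`, and all elements of `U / D` outside the abelian maximal subgroup `W ⟨b₀ ^ p⟩ / D` are killed by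
`p ^ (m - 1)`. A maximal subgroup containing an element of order `p ^ m` contains `a₀`, hence is
this abelian one. If there were two abelian maximal subgroups, the commutator `a₁` would be central
in `U / D`; this fails unless `p = m = 2`.
-/

namespace ExpCrit

open scoped commutatorElement

section PowerIdentities

theorem geom_sum_add_one {R : Type*} [Ring R] (x : R) (n : ℕ) :
    ∑ i ∈ Finset.range n, (x + 1) ^ i = ∑ j ∈ Finset.range n, (n.choose (j + 1) : R) * x ^ j := by
  have h := congrArg (Polynomial.aeval (R := ℤ) x)
    (Polynomial.geom_sum_X_comp_X_add_one_eq_sum (R := ℤ) n)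
  simpa [Polynomial.aeval_comp] using h

theorem sub_one_pow_eq_neg_sum_choose_nsmul {R : Type*} [Ring R] {x : R} {n : ℕ} (hn : n ≠ 0)
    (hx : x ^ n = 1) :
    (x - 1) ^ n = -∑ j ∈ Finset.Icc 1 (n - 1), n.choose j • (x - 1) ^ j := by
  obtain ⟨n, rfl⟩ := Nat.exists_eq_succ_of_ne_zero hn
  have hsum : ∑ j ∈ Finset.range (n + 1 + 1), (n + 1).choose j • (x - 1) ^ j = 1 := by
    simpa [hx, ← nsmul_eq_mul'] using ((Commute.one_right (x - 1)).add_pow (n + 1)).symm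
  rw [Finset.sum_range_succ, Finset.range_eq_Ico, Finset.sum_eq_sum_Ico_succ_bot n.succ_pos,
    Nat.choose_self, Nat.choose_zero_right, one_smul, one_smul, pow_zero, add_assoc,
    add_eq_left] at hsum
  exact eq_neg_of_add_eq_zero_right hsum

variable {H G : Type*} [Group G]

theorem map_iterate_eq_conj {f : H → G} {θ : H → H} {b : G}
    (hb : ∀ h, b⁻¹ * f h * b = f (θ h)) (n : ℕ) (h : H) :
    f (θ^[n] h) = (b ^ n)⁻¹ * f h * b ^ n := by
  induction n with
  | zero => simp
  | succ n ih =>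
    rw [Function.iterate_succ_apply', ← hb, ih, pow_succ]
    group

theorem mul_map_ofAdd_pow {V : Type*} [AddCommGroup V] {f : Multiplicative V →* G}
    {θ : AddMonoid.End V} {b : G}
    (hb : ∀ v, b⁻¹ * f (.ofAdd v) * b = f (.ofAdd (θ v))) (n : ℕ) (v : V) :
    (b * f (.ofAdd v)) ^ n = b ^ n * f (.ofAdd ((∑ i ∈ Finset.range n, θ ^ i) v)) := by
  induction n with
  | zero => simp [show (0 : AddMonoid.End V) v = 0 from rfl]
  | succ n ih =>
    have hsum : (∑ i ∈ Finset.range (n + 1), θ ^ i) v =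
        θ ((∑ i ∈ Finset.range n, θ ^ i) v) + v :=
      DFunLike.congr_fun geom_sum_succ v
    rw [pow_succ, ih, hsum, ofAdd_add, map_mul, ← hb, pow_succ]
    group

theorem mem_of_pow_mem_of_coprime {K : Subgroup G} {g : G} {k n : ℕ} (hkn : k.Coprime n)
    (hk : g ^ k ∈ K) (hn : g ^ n ∈ K) : g ∈ K := by
  have hgcd : g ^ (k.gcd n : ℤ) ∈ K := by
    rw [Nat.gcd_eq_gcd_ab, zpow_add, zpow_mul, zpow_mul, zpow_natCast, zpow_natCast]
    exact K.mul_mem (K.zpow_mem hk _) (K.zpow_mem hn _)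
  simpa [hkn.gcd_eq_one] using hgcd

theorem inf_le_center_of_sup_eq_top {A B : Subgroup G} [IsMulCommutative A] [IsMulCommutative B]
    (hAB : A ⊔ B = ⊤) : A ⊓ B ≤ Subgroup.center G := by
  rw [← Subgroup.centralizer_univ, ← Subgroup.coe_top, ← hAB, Subgroup.le_centralizer_iff]
  refine sup_le ?_ ?_
  · exact A.le_centralizer.trans (Subgroup.centralizer_le inf_le_left)
  · exact B.le_centralizer.trans (Subgroup.centralizer_le inf_le_right)

end PowerIdentities

section PGroup

variable {p : ℕ} [hp : Fact p.Prime] {G : Type*} [Group G] [Finite G] {M : Subgroup G}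

theorem exists_isCoatom_mem (hG : ¬ IsMulCommutative G) (g : G) :
    ∃ M : Subgroup G, IsCoatom M ∧ g ∈ M := by
  have hg : Subgroup.zpowers g ≠ ⊤ := fun h =>
    have : IsCyclic G := isCyclic_iff_exists_zpowers_eq_top.2 ⟨g, h⟩
    hG IsCyclic.isMulCommutative
  obtain ⟨M, hM, hgM⟩ := (eq_top_or_exists_le_coatom _).resolve_left hg
  exact ⟨M, hM, hgM (Subgroup.mem_zpowers g)⟩

theorem isExponentCritical_iff_of_exponent_eq {m : ℕ} (hm : m ≠ 0)
    (hexp : Monoid.exponent G = p ^ m) :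
    IsExponentCritical G ↔
      ∀ M : Subgroup G, IsCoatom M → ¬ IsMulCommutative M → ∀ g ∈ M, g ^ p ^ (m - 1) = 1 := by
  set L := (Set.toFinite {H : Subgroup G | H ≠ ⊤ ∧ ¬ IsMulCommutative H}).toFinset.lcm
    fun H => Monoid.exponent H with hL
  have hLdvd : L ∣ p ^ m := hexp ▸ Finset.lcm_dvd fun H _ =>
    Monoid.exponent_dvd_of_monoidHom H.subtype H.subtype_injective
  have hcrit : IsExponentCritical G ↔ L ∣ p ^ (m - 1) := by
    rw [IsExponentCritical, hexp]
    obtain ⟨k, hk, hLk⟩ := (Nat.dvd_prime_pow hp.out).1 hLdvd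
    rw [← hL, hLk, Nat.pow_dvd_pow_iff_le_right hp.out.one_lt,
      (Nat.pow_right_injective hp.out.two_le).ne_iff]
    omega
  have hpow (H : Subgroup G) (n : ℕ) : Monoid.exponent H ∣ n ↔ ∀ g ∈ H, g ^ n = 1 := by
    simp [Monoid.exponent_dvd_iff_forall_pow_eq_one, Subtype.ext_iff]
  rw [hcrit, hL, Finset.lcm_dvd_iff]
  simp only [Set.Finite.mem_toFinset, Set.mem_ofPred_eq, hpow]
  refine ⟨fun h M hM hMc => h M ⟨hM.1, hMc⟩, fun h H ⟨hH, hHc⟩ g hg => ?_⟩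
  obtain ⟨M, hM, hHM⟩ := (eq_top_or_exists_le_coatom H).resolve_left hH
  refine h M hM (fun _ => hHc ?_) g (hHM hg)
  exact .of_setLike_mul_comm fun x hx y hy => setLike_mul_comm (hHM hx) (hHM hy)

theorem normal_of_isCoatom (hG : IsPGroup p G) (hM : IsCoatom M) : M.Normal :=
  have := hG.isNilpotent
  Subgroup.NormalizerCondition.normal_of_coatom M Group.normalizerCondition_of_isNilpotent hM

theorem index_of_isCoatom (hG : IsPGroup p G) (hM : IsCoatom M) : M.index = p := by
  obtain ⟨k, hk⟩ := (hG.to_subgroup M).exists_card_eq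
  have hdvd : p ^ (k + 1) ∣ Nat.card G := by
    obtain ⟨j, hj⟩ := (hG.index M)
    have hj0 : j ≠ 0 := by
      rintro rfl
      exact hM.1 (Subgroup.index_eq_one.1 (by simpa using hj))
    rw [← M.card_mul_index, hk, hj, pow_succ]
    exact mul_dvd_mul_left _ (dvd_pow_self p hj0)
  obtain ⟨K, hK, hMK⟩ := Sylow.exists_subgroup_card_pow_succ hdvd hk
  have hne : M ≠ K := by
    rintro rfl
    exact k.succ_ne_self (Nat.pow_right_injective hp.out.two_le (hK.symm.trans hk))
  have hKtop : K = ⊤ := hM.2 K (hMK.lt_of_ne hne)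
  have hcard := M.card_mul_index
  rw [hk, ← Subgroup.card_top, ← hKtop, hK, pow_succ] at hcard
  exact Nat.eq_of_mul_eq_mul_left (pow_pos hp.out.pos k) hcard

theorem pow_mem_of_isCoatom (hG : IsPGroup p G) (hM : IsCoatom M) (g : G) : g ^ p ∈ M := by
  have := normal_of_isCoatom hG hM
  exact index_of_isCoatom hG hM ▸ M.pow_index_mem g

theorem commutator_le_of_isCoatom (hG : IsPGroup p G) (hM : IsCoatom M) : commutator G ≤ M := by
  have := normal_of_isCoatom hG hM
  have : IsCyclic (G ⧸ M) := isCyclic_of_prime_card (index_of_isCoatom hG hM)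
  exact Subgroup.Normal.quotient_commutative_iff_commutator_le.1 IsCyclic.isMulCommutative

theorem commutator_mem_of_isCoatom (hG : IsPGroup p G) (hM : IsCoatom M) (g h : G) : ⁅g, h⁆ ∈ M :=
  commutator_le_of_isCoatom hG hM
    (Subgroup.commutator_mem_commutator (Subgroup.mem_top g) (Subgroup.mem_top h))

theorem commutator_le_center_of_isCoatom (hG : IsPGroup p G) {A B : Subgroup G}
    [IsMulCommutative A] [IsMulCommutative B] (hA : IsCoatom A) (hB : IsCoatom B) (hAB : A ≠ B) :
    commutator G ≤ Subgroup.center G :=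
  (le_inf (commutator_le_of_isCoatom hG hA) (commutator_le_of_isCoatom hG hB)).trans
    (inf_le_center_of_sup_eq_top (hA.sup_eq_top_of_ne hB hAB))

theorem pow_eq_one_of_notMem_isCoatom (hG : IsPGroup p G) (hM : IsCoatom M) {b : G} (hb : b ∉ M)
    {n : ℕ} (hbM : ∀ x ∈ M, (b * x) ^ n = 1) {y : G} (hy : y ∉ M) : y ^ n = 1 := by
  have := normal_of_isCoatom hG hM
  have hy1 : (y : G ⧸ M) ≠ 1 := by rwa [Ne, QuotientGroup.eq_one_iff]
  obtain ⟨k, hk⟩ := mem_powers_of_prime_card (index_of_isCoatom hG hM) hy1 (g' := (b : G ⧸ M))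
  have hyk : b⁻¹ * y ^ k ∈ M := QuotientGroup.eq.1 hk.symm
  have hpk : ¬ p ∣ k := by
    rintro ⟨c, rfl⟩
    have hyp : y ^ (p * c) ∈ M := pow_mul y p c ▸ M.pow_mem (pow_mem_of_isCoatom hG hM y) c
    exact hb (inv_mem_iff.1 ((M.mul_mem_cancel_right hyp).1 hyk))
  have hkn : orderOf y ∣ k * n := by
    rw [orderOf_dvd_iff_pow_eq_one, pow_mul, ← hbM _ hyk, mul_inv_cancel_left]
  exact orderOf_dvd_iff_pow_eq_one.1 ((hG.orderOf_coprime
    ((Nat.Prime.coprime_iff_not_dvd hp.out).2 hpk) y).dvd_of_dvd_mul_left hkn)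

end PGroup

section AddW

variable (p m : ℕ)

theorem aN_val (i : Fin p) : aN p m i = a p m i := by
  simp [aN]

theorem aN_eq_single {j : ℕ} (hj : j < p) : aN p m j = Pi.single ⟨j, hj⟩ 1 := by
  simp [aN, hj, a]

theorem ord_of_ne_zero {i : Fin p} (hi : (i : ℕ) ≠ 0) : ord p m i = p ^ (m - 1) :=
  if_neg hi

theorem nsmul_aN_eq_zero_iff {j : ℕ} (hj : j < p) (n : ℕ) :
    n • aN p m j = 0 ↔ ord p m ⟨j, hj⟩ ∣ n := by
  rw [aN_eq_single p m hj, ← Pi.single_smul, Pi.single_eq_zero_iff, nsmul_one,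
    ZMod.natCast_eq_zero_iff]

theorem nsmul_aN_eq_zero_iff_of_ne_zero {j : ℕ} (hj : j < p) (hj0 : j ≠ 0) (n : ℕ) :
    n • aN p m j = 0 ↔ p ^ (m - 1) ∣ n := by
  rw [nsmul_aN_eq_zero_iff p m hj, ord_of_ne_zero p m hj0]

theorem card_addW [NeZero p] : Nat.card (AddW p m) = p ^ m * (p ^ (m - 1)) ^ (p - 1) := by
  obtain ⟨q, rfl⟩ := Nat.exists_eq_succ_of_ne_zero (NeZero.ne p)
  simp [Nat.card_pi, Fin.prod_univ_succ, ord]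

theorem exists_addMonoidHom_of_ord_nsmul_eq_zero {V : Type*} [AddCommGroup V] {x : Fin p → V}
    (hx : ∀ i, ord p m i • x i = 0) : ∃ g : AddW p m →+ V, ∀ i, g (a p m i) = x i := by
  classical
  let c (i : Fin p) : {f : ℤ →+ V // f (ord p m i) = 0} :=
    ⟨zmultiplesHom V (x i), by simpa using hx i⟩
  refine ⟨∑ i, (ZMod.lift (ord p m i) (c i)).comp
    (Pi.evalAddMonoidHom (fun i : Fin p => ZMod (ord p m i)) i), fun i => ?_⟩
  have hone : ZMod.lift (ord p m i) (c i) 1 = x i := by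
    simpa [c] using ZMod.lift_coe (ord p m i) (c i) 1
  rw [AddMonoidHom.finsetSum_apply, Finset.sum_eq_single i]
  · simpa [a] using hone
  · intro j _ hj
    simp [a, hj]
  · simp

variable [hp : Fact p.Prime]

theorem closure_range_a : AddSubmonoid.closure (Set.range (a p m)) = ⊤ := by
  refine eq_top_iff.2 fun w _ => ?_
  rw [← Finset.univ_sum_single w]
  refine sum_mem fun i _ => ?_
  have hi : Pi.single i (w i) = (w i).val • a p m i := by
    rw [a, ← Pi.single_smul, nsmul_one, ZMod.natCast_zmod_val]
  exact hi ▸ nsmul_mem (AddSubmonoid.subset_closure (Set.mem_range_self i)) _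

theorem pow_nsmul_eq_zero (w : AddW p m) : p ^ m • w = 0 := by
  have h : (p ^ m • 1 : AddMonoid.End (AddW p m)) = 0 :=
    end_ext p m fun i => aN_val p m i ▸ pow_nsmul_aN p m i
  exact DFunLike.congr_fun h w

theorem pow_pred_nsmul_phiEnd_sub_one (w : AddW p m) : p ^ (m - 1) • (phiEnd p m - 1) w = 0 := by
  have h : (p ^ (m - 1) • (phiEnd p m - 1) : AddMonoid.End (AddW p m)) = 0 := by
    refine end_ext p m fun i => ?_
    change p ^ (m - 1) • (phiEnd p m - 1) (a p m i) = 0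
    rw [← aN_val]
    rcases lt_or_ge ((i : ℕ) + 1) p with hi | hi
    · rw [phiEnd_aN_of_lt _ _ _ hi, pow_pred_nsmul_aN _ _ _ (Nat.succ_ne_zero _)]
    · have := hp.out.two_le
      rw [← map_nsmul, pow_pred_nsmul_aN _ _ _ (by omega), map_zero]
  exact DFunLike.congr_fun h w

theorem exists_eq_nsmul_aN_zero_add (w : AddW p m) :
    ∃ (k : ℕ) (u : AddW p m), w = k • aN p m 0 + (phiEnd p m - 1) u := by
  have htop : AddSubmonoid.multiples (aN p m 0) ⊔ AddMonoidHom.mrange (phiEnd p m - 1) = ⊤ := by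
    rw [eq_top_iff, ← closure_range_a, AddSubmonoid.closure_le]
    rintro _ ⟨i, rfl⟩
    rw [← aN_val]
    rcases Nat.eq_zero_or_eq_succ_pred (i : ℕ) with hi | hi
    · exact AddSubmonoid.mem_sup_left (hi ▸ AddSubmonoid.mem_multiples _)
    · rw [hi]
      exact AddSubmonoid.mem_sup_right ⟨_, phiEnd_aN_of_lt p m _ (hi ▸ i.2)⟩
  obtain ⟨_, ⟨k, rfl⟩, _, ⟨u, rfl⟩, hw⟩ := AddSubmonoid.mem_sup.1 (htop ▸ AddSubmonoid.mem_top w)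
  exact ⟨k, u, hw.symm⟩

/-- The generator of `D`, as an element of `W` in additive notation. -/
def dW : AddW p m := p ^ (m - 1) • aN p m 0 + p ^ (m - 2) • aN p m (p - 1)

theorem dU_eq_inl_dW : dU p m = SemidirectProduct.inl (.ofAdd (dW p m)) :=
  dU_eq p m

/-- The norm `1 + φ + ⋯ + φ ^ (p - 1)` of the action of `φ` on `W`. -/
noncomputable def normEnd : AddMonoid.End (AddW p m) := ∑ i ∈ Finset.range p, phiEnd p m ^ i

theorem normEnd_phiEnd_sub_one (w : AddW p m) : normEnd p m ((phiEnd p m - 1) w) = 0 := by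
  have h : normEnd p m * (phiEnd p m - 1) = 0 := by
    rw [normEnd, geom_sum_mul, phiEnd_pow, sub_self]
  exact DFunLike.congr_fun h w

theorem normEnd_aN_zero :
    normEnd p m (aN p m 0) = ∑ j ∈ Finset.range p, p.choose (j + 1) • aN p m j := by
  have h := geom_sum_add_one (phiEnd p m - 1) p
  rw [sub_add_cancel] at h
  rw [normEnd, h, end_sum_apply]
  refine Finset.sum_congr rfl fun j hj => ?_
  rw [end_mul_apply, AddMonoid.End.natCast_apply, pow_aN_zero _ _ _ (Finset.mem_range.1 hj)]

variable {m}

theorem pow_nsmul_normEnd_aN_zero (hm : 2 ≤ m) : p ^ (m - 2) • normEnd p m (aN p m 0) = dW p m := by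
  have hpm : p ^ (m - 2) * p = p ^ (m - 1) := by rw [← pow_succ]; congr 1; omega
  have hmiddle (j : ℕ) (hj : j ∈ Finset.range p) (h0 : j ≠ 0) (h1 : j ≠ p - 1) :
      p ^ (m - 2) • p.choose (j + 1) • aN p m j = 0 := by
    rw [Finset.mem_range] at hj
    obtain ⟨c, hc⟩ := hp.out.dvd_choose_self (k := j + 1) (by omega) (by omega)
    rw [hc, smul_smul, ← mul_assoc, hpm, mul_comm, mul_smul, pow_pred_nsmul_aN _ _ _ h0, smul_zero]
  have hp1 : p - 1 ∈ Finset.range p := Finset.mem_range.2 (Nat.sub_lt hp.out.pos one_pos)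
  have := hp.out.two_le
  rw [normEnd_aN_zero, Finset.smul_sum, Finset.sum_eq_add_of_mem 0 (p - 1)
    (Finset.mem_range.2 hp.out.pos) hp1 (by omega) fun j hj hne => hmiddle j hj hne.1 hne.2, dW,
    Nat.sub_add_cancel hp.out.one_le, Nat.choose_self, zero_add, Nat.choose_one_right, one_smul,
    smul_smul, hpm]

theorem pow_nsmul_normEnd_mem (hm : 2 ≤ m) (w : AddW p m) :
    p ^ (m - 2) • normEnd p m w ∈ AddSubgroup.zmultiples (dW p m) := by
  obtain ⟨k, u, rfl⟩ := exists_eq_nsmul_aN_zero_add p m w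
  rw [map_add, normEnd_phiEnd_sub_one, add_zero, map_nsmul, smul_comm,
    pow_nsmul_normEnd_aN_zero p hm]
  exact AddSubgroup.nsmul_mem_zmultiples _ _

theorem nsmul_dW (hm : 2 ≤ m) : p • dW p m = 0 := by
  have := hp.out.two_le
  rw [dW, smul_add, smul_smul, smul_smul, ← pow_succ', ← pow_succ',
    show m - 1 + 1 = m by omega, show m - 2 + 1 = m - 1 by omega, pow_nsmul_aN,
    pow_pred_nsmul_aN _ _ _ (by omega), add_zero]

theorem aN_apply_zero {j : ℕ} (hj : j ≠ 0) : aN p m j ⟨0, hp.out.pos⟩ = 0 := by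
  unfold aN
  split_ifs
  · exact Pi.single_eq_of_ne (by simpa [Fin.ext_iff] using hj.symm) _
  · rfl

theorem dW_apply_zero : dW p m ⟨0, hp.out.pos⟩ =
    ((p ^ (m - 1) : ℕ) : ZMod (ord p m ⟨0, hp.out.pos⟩)) := by
  have := hp.out.two_le
  rw [dW, Pi.add_apply, Pi.smul_apply, Pi.smul_apply, aN_apply_zero p (j := p - 1) (by omega),
    smul_zero, add_zero, aN_eq_single p m hp.out.pos, Pi.single_eq_same, nsmul_one]

theorem zsmul_dW_apply_zero_eq_zero_iff (hm : 2 ≤ m) (k : ℤ) :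
    (k • dW p m) ⟨0, hp.out.pos⟩ = 0 ↔ (p : ℤ) ∣ k := by
  have hord : ord p m ⟨0, hp.out.pos⟩ = p * p ^ (m - 1) := by
    rw [ord, if_pos rfl, ← pow_succ']
    congr 1
    omega
  rw [Pi.smul_apply, dW_apply_zero, zsmul_eq_mul, ← Int.cast_natCast (p ^ (m - 1)),
    ← Int.cast_mul, ZMod.intCast_zmod_eq_zero_iff_dvd, hord, Nat.cast_mul]
  exact Int.mul_dvd_mul_iff_right (by exact_mod_cast pow_ne_zero _ hp.out.ne_zero)

theorem eq_zero_of_mem_zmultiples_dW (hm : 2 ≤ m) {v : AddW p m}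
    (hv : v ∈ AddSubgroup.zmultiples (dW p m)) (h0 : v ⟨0, hp.out.pos⟩ = 0) : v = 0 := by
  obtain ⟨k, rfl⟩ := AddSubgroup.mem_zmultiples_iff.1 hv
  obtain ⟨c, rfl⟩ := (zsmul_dW_apply_zero_eq_zero_iff p hm k).1 h0
  rw [mul_comm, mul_smul, natCast_zsmul, nsmul_dW p hm, smul_zero]

theorem addOrderOf_dW (hm : 2 ≤ m) : addOrderOf (dW p m) = p := by
  refine addOrderOf_eq_prime (nsmul_dW p hm) fun h => ?_
  have hone := (zsmul_dW_apply_zero_eq_zero_iff p hm 1).1 (by rw [h, smul_zero]; rfl)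
  exact hp.out.one_lt.not_ge (Nat.le_of_dvd one_pos (by exact_mod_cast hone))

theorem nsmul_aN_mem_zmultiples_dW_iff (hm : 2 ≤ m) {j : ℕ} (hj : j < p) (hj0 : j ≠ 0) (n : ℕ) :
    n • aN p m j ∈ AddSubgroup.zmultiples (dW p m) ↔ p ^ (m - 1) ∣ n := by
  rw [← nsmul_aN_eq_zero_iff_of_ne_zero p m hj hj0]
  refine ⟨fun h => eq_zero_of_mem_zmultiples_dW p hm h ?_, fun h => h ▸ zero_mem _⟩
  rw [Pi.smul_apply, aN_apply_zero p hj0, smul_zero]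

theorem aN_notMem_zmultiples_dW (hm : 2 ≤ m) {j : ℕ} (hj : j < p) (hj0 : j ≠ 0) :
    aN p m j ∉ AddSubgroup.zmultiples (dW p m) := by
  rw [← one_nsmul (aN p m j), nsmul_aN_mem_zmultiples_dW_iff p hm hj hj0, Nat.dvd_one]
  exact (Nat.one_lt_pow (by omega) hp.out.one_lt).ne'

theorem pow_nsmul_aN_zero_notMem (hm : 2 ≤ m) :
    p ^ (m - 1) • aN p m 0 ∉ AddSubgroup.zmultiples (dW p m) := by
  have := hp.out.two_le
  intro h
  have hlast : p ^ (m - 2) • aN p m (p - 1) ∈ AddSubgroup.zmultiples (dW p m) :=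
    (AddSubgroup.add_mem_cancel_left _ h).1 (AddSubgroup.mem_zmultiples (dW p m))
  rw [nsmul_aN_mem_zmultiples_dW_iff p hm (by omega) (by omega),
    Nat.pow_dvd_pow_iff_le_right hp.out.one_lt] at hlast
  omega

theorem phiEnd_sub_one_aN_one_notMem (hm : 2 ≤ m) (hpm : p ≠ 2 ∨ 3 ≤ m) :
    (phiEnd p m - 1) (aN p m 1) ∉ AddSubgroup.zmultiples (dW p m) := by
  rcases hp.out.two_le.lt_or_eq with hp2 | rfl
  · rw [phiEnd_aN_of_lt _ _ _ hp2]
    exact aN_notMem_zmultiples_dW p hm hp2 two_ne_zero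
  · have hlast : (phiEnd 2 m - 1) (aN 2 m 1) = -(2 • aN 2 m 1) := by
      simpa using phiEnd_aN_last 2 m
    rw [hlast, neg_mem_iff, nsmul_aN_mem_zmultiples_dW_iff 2 hm one_lt_two one_ne_zero,
      Nat.pow_dvd_iff_le_padicValNat one_lt_two.ne' two_ne_zero]
    simp
    omega

end AddW

section UniversalProperty

variable (p m : ℕ) [hp : Fact p.Prime]

theorem exists_eq_ofAdd_one_pow (c : B p m) : ∃ n : ℕ, c = .ofAdd 1 ^ n := by
  have : NeZero (p ^ (m - 1)) := ⟨pow_ne_zero _ hp.out.ne_zero⟩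
  exact ⟨ZMod.val c.toAdd, Multiplicative.toAdd.injective (by simp)⟩

theorem exists_eq_inl_mul_bU_pow (u : U p m) :
    ∃ (w : W p m) (n : ℕ), u = SemidirectProduct.inl w * bU p m ^ n := by
  obtain ⟨n, hn⟩ := exists_eq_ofAdd_one_pow p m u.right
  refine ⟨u.left, n, ?_⟩
  rw [bU, ← map_pow, ← hn, SemidirectProduct.inl_left_mul_inr_right]

theorem bU_pow_eq_one : bU p m ^ p ^ (m - 1) = 1 := by
  rw [bU, ← map_pow, ← ofAdd_nsmul]
  simp

theorem commute_bU_pow_prime (w : W p m) :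
    Commute (bU p m ^ p) (SemidirectProduct.inl w) := by
  have h := map_iterate_eq_conj (bU_inv_mul_mul p m) p w
  rw [← hom_coe_pow _ rfl (fun _ _ => rfl), ← ofAdd_toAdd w, phi_pow_apply, phiEnd_pow,
    end_one_apply, ofAdd_toAdd, mul_assoc] at h
  exact (inv_mul_eq_iff_eq_mul.1 h.symm).symm

variable {m} in
theorem bU_mul_inl_pow (hm : 2 ≤ m) (w : AddW p m) :
    (bU p m * SemidirectProduct.inl (.ofAdd w)) ^ p ^ (m - 1) =
      SemidirectProduct.inl (.ofAdd (p ^ (m - 2) • normEnd p m w)) := by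
  have hpm : p ^ (m - 1) = p * p ^ (m - 2) := by rw [← pow_succ']; congr 1; omega
  have hb : (bU p m ^ p) ^ p ^ (m - 2) = 1 := by
    rw [← pow_mul]
    exact (congrArg (bU p m ^ ·) hpm.symm).trans (bU_pow_eq_one p m)
  set x := bU p m * SemidirectProduct.inl (.ofAdd w)
  have hx : x ^ p = bU p m ^ p * SemidirectProduct.inl (.ofAdd (normEnd p m w)) :=
    mul_map_ofAdd_pow (θ := phiEnd p m) (fun v => bU_inv_mul_mul p m (.ofAdd v)) p w
  calc x ^ p ^ (m - 1) = x ^ (p * p ^ (m - 2)) := congrArg (x ^ ·) hpm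
    _ = (SemidirectProduct.inl (.ofAdd (normEnd p m w))) ^ p ^ (m - 2) := by
      rw [pow_mul, hx, (commute_bU_pow_prime p m _).mul_pow, hb, one_mul]
    _ = SemidirectProduct.inl (.ofAdd (p ^ (m - 2) • normEnd p m w)) := by
      rw [← map_pow, ofAdd_nsmul]

variable {m} in
theorem dU_eq_pow (hm : 2 ≤ m) : dU p m = (bU p m * aU p m 0) ^ p ^ (m - 1) := by
  rw [aU, bU_mul_inl_pow p hm, pow_nsmul_normEnd_aN_zero p hm, dU_eq_inl_dW]

theorem exists_addMonoidHom_equivariant {V : Type*} [AddCommGroup V] {θ : AddMonoid.End V}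
    (hθ : θ ^ p = 1) {x : V} (hx : p ^ m • x = 0) (hθx : p ^ (m - 1) • (θ - 1) x = 0) :
    ∃ g : AddW p m →+ V, (∀ w, g (phiEnd p m w) = θ (g w)) ∧ g (aN p m 0) = x := by
  have hord (i : Fin p) : ord p m i • ((θ - 1) ^ (i : ℕ)) x = 0 := by
    rw [← map_nsmul]
    unfold ord
    split_ifs with hi
    · rw [hx, map_zero]
    · obtain ⟨j, hj⟩ := Nat.exists_eq_succ_of_ne_zero hi
      rw [hj, pow_succ, AddMonoid.End.coe_mul, Function.comp_apply, map_nsmul (θ - 1), hθx,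
        map_zero]
  obtain ⟨g, hg⟩ := exists_addMonoidHom_of_ord_nsmul_eq_zero p m hord
  have hgN (j : ℕ) (hj : j < p) : g (aN p m j) = ((θ - 1) ^ j) x := by
    simpa [aN, hj] using hg ⟨j, hj⟩
  have hpow (j : ℕ) : (θ - 1) (((θ - 1) ^ j) x) = ((θ - 1) ^ (j + 1)) x :=
    DFunLike.congr_fun (pow_succ' (θ - 1) j).symm x
  have hlast : ((θ - 1) ^ p) x = -∑ j ∈ Finset.Icc 1 (p - 1), p.choose j • ((θ - 1) ^ j) x := by
    simp only [← AddMonoid.End.smul_def, ← smul_assoc, ← Finset.sum_smul, ← neg_smul,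
      sub_one_pow_eq_neg_sum_choose_nsmul hp.out.ne_zero hθ]
  have hgφ (i : Fin p) : g ((phiEnd p m - 1) (a p m i)) = (θ - 1) (g (a p m i)) := by
    rw [hg, hpow, ← aN_val]
    rcases lt_or_ge ((i : ℕ) + 1) p with hi | hi
    · rw [phiEnd_aN_of_lt _ _ _ hi, hgN _ hi]
    · have hi' : (i : ℕ) = p - 1 := by omega
      rw [hi', phiEnd_aN_last, Nat.sub_add_cancel hp.out.one_le, hlast, map_neg, map_sum]
      congr! 2 with j hj
      rw [map_nsmul, hgN j (by grind [hp.out.pos])]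
  have hcomp : g.comp (phiEnd p m) = AddMonoidHom.comp θ g := by
    refine AddMonoidHom.eq_of_eqOn_denseM (closure_range_a p m) ?_
    rintro _ ⟨i, rfl⟩
    have h : g (phiEnd p m (a p m i)) - g (a p m i) = θ (g (a p m i)) - g (a p m i) :=
      (map_sub g _ _).symm.trans (hgφ i)
    exact sub_left_injective h
  exact ⟨g, DFunLike.congr_fun hcomp, hgN 0 hp.out.pos⟩

theorem exists_monoidHom_of_conj_eq {G : Type*} [Group G] {f : W p m →* G} {b : G}
    (hb : b ^ p ^ (m - 1) = 1) (hf : ∀ w, b⁻¹ * f w * b = f (phi p m w)) :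
    ∃ F : U p m →* G, F (bU p m) = b ∧ ∀ w, F (SemidirectProduct.inl w) = f w := by
  let fB : B p m →* G := AddMonoidHom.toMultiplicativeLeft
    (ZMod.lift (p ^ (m - 1)) ⟨zmultiplesHom (Additive G) (.ofMul b), by
      rw [zmultiplesHom_apply, natCast_zsmul, ← ofMul_pow, hb, ofMul_one]⟩)
  have hfB : fB (.ofAdd 1) = b := by
    change (ZMod.lift _ _ 1 : Additive G).toMul = b
    rw [← Int.cast_one, ZMod.lift_coe]
    simp
  have hcompat (c : B p m) :
      f.comp (act p m c).toMonoidHom = (MulAut.conj (fB c)).toMonoidHom.comp f := by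
    obtain ⟨n, rfl⟩ := exists_eq_ofAdd_one_pow p m c
    refine MonoidHom.ext fun w => ?_
    change f (act p m (.ofAdd 1 ^ n) w) = fB (.ofAdd 1 ^ n) * f w * (fB (.ofAdd 1 ^ n))⁻¹
    have h := map_iterate_eq_conj hf n (act p m (.ofAdd 1 ^ n) w)
    rw [← hom_coe_pow _ rfl (fun _ _ => rfl), map_pow, act_gen, inv_pow, MulAut.apply_inv_self] at h
    rw [map_pow, map_pow, hfB, act_gen, inv_pow, h]
    group
  refine ⟨SemidirectProduct.lift f fB hcompat, ?_, SemidirectProduct.lift_inl f fB hcompat⟩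
  rw [bU, SemidirectProduct.lift_inr, hfB]

open scoped IsMulCommutative in
theorem exists_monoidHom_equivariant {G : Type*} [Group G] {A : Subgroup G} [A.Normal]
    [IsMulCommutative A] {x b : G} (hxA : x ∈ A) (hbA : b ^ p ∈ A) (hx : x ^ p ^ m = 1)
    (hbx : (b⁻¹ * x * b * x⁻¹) ^ p ^ (m - 1) = 1) :
    ∃ f : W p m →* G, (∀ w, b⁻¹ * f w * b = f (phi p m w)) ∧ f (.ofAdd (aN p m 0)) = x := by
  let V := Additive A
  let θ : AddMonoid.End V :=
    MonoidHom.toAdditive (MulAut.conjNormal b⁻¹ : MulAut A).toMonoidHom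
  let x' : V := .ofMul ⟨x, hxA⟩
  have hconj (v : V) : b⁻¹ * (v.toMul : G) * b = ((θ v).toMul : G) := by
    change _ = ((MulAut.conjNormal b⁻¹ v.toMul : A) : G)
    rw [MulAut.conjNormal_apply, inv_inv]
  have hθ : θ ^ p = 1 := by
    refine AddMonoidHom.ext fun v => Additive.toMul.injective (Subtype.ext ?_)
    have hcomm : b ^ p * (v.toMul : G) = v.toMul * b ^ p := setLike_mul_comm hbA v.toMul.2
    have hpow := map_iterate_eq_conj hconj p v
    rwa [← AddMonoid.End.coe_pow, mul_assoc, ← hcomm, inv_mul_cancel_left] at hpow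
  have hx' : p ^ m • x' = 0 := Additive.toMul.injective (Subtype.ext hx)
  have hθx' : p ^ (m - 1) • (θ - 1) x' = 0 := by
    refine Additive.toMul.injective (Subtype.ext ?_)
    change (((θ x').toMul / x'.toMul : A) : G) ^ p ^ (m - 1) = 1
    rw [Subgroup.coe_div, ← hconj, div_eq_mul_inv]
    exact hbx
  obtain ⟨g, hgφ, hg⟩ := exists_addMonoidHom_equivariant p m hθ hx' hθx'
  refine ⟨A.subtype.comp (AddMonoidHom.toMultiplicativeLeft g), fun w => ?_, ?_⟩
  · change b⁻¹ * ((g w.toAdd).toMul : A) * b = ((g (phiEnd p m w.toAdd)).toMul : A)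
    rw [hgφ, ← hconj]
  · exact congrArg (fun v => (v.toMul : G)) hg

variable {m} in
theorem exists_monoidHom_quotient (hm : 2 ≤ m) {G : Type*} [Group G] {A : Subgroup G} [A.Normal]
    [IsMulCommutative A] {x b : G} (hxA : x ∈ A) (hbA : b ^ p ∈ A) (hx : x ^ p ^ m = 1)
    (hb : b ^ p ^ (m - 1) = 1) (hcomm : (b⁻¹ * x * b * x⁻¹) ^ p ^ (m - 1) = 1)
    (hbx : (b * x) ^ p ^ (m - 1) = 1) :
    ∃ F : U p m ⧸ D p m →* G, F (bU p m) = b ∧ F (aU p m 0) = x := by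
  obtain ⟨f, hf, hfx⟩ := exists_monoidHom_equivariant p m hxA hbA hx hcomm
  obtain ⟨F, hFb, hFf⟩ := exists_monoidHom_of_conj_eq p m hb hf
  have hFx : F (aU p m 0) = x := (hFf _).trans hfx
  have hFD : D p m ≤ F.ker := by
    rw [D, Subgroup.zpowers_le, MonoidHom.mem_ker, dU_eq_pow p hm, map_pow, map_mul, hFb, hFx, hbx]
  exact ⟨QuotientGroup.lift (D p m) F hFD, hFb, hFx⟩

end UniversalProperty

section TypeA

variable {p m : ℕ} [hp : Fact p.Prime] {P : Type*} [Group P] [Finite P] {A : Subgroup P}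
  [IsMulCommutative A]

theorem IsTypeA.exists_pow_ne_one (hP : IsTypeA p m P) (hm : m ≠ 0) :
    ∃ x : P, x ^ p ^ (m - 1) ≠ 1 := by
  by_contra! h
  have hdvd := Monoid.exponent_dvd_of_forall_pow_eq_one h
  rw [hP.exponent_eq, Nat.pow_dvd_pow_iff_le_right hp.out.one_lt] at hdvd
  omega

theorem IsTypeA.pow_eq_one_of_mem_isCoatom (hP : IsTypeA p m P) (hm : m ≠ 0) (hA : IsCoatom A)
    {M : Subgroup P} (hM : IsCoatom M) (hMA : M ≠ A) {y : P} (hy : y ∈ M) :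
    y ^ p ^ (m - 1) = 1 :=
  (isExponentCritical_iff_of_exponent_eq hm hP.exponent_eq).1 hP.exponentCritical M hM
    (fun hMc => hMA (hP.typeA.unique ⟨hM, hMc⟩ ⟨hA, inferInstance⟩)) y hy

theorem IsTypeA.pow_eq_one_of_notMem (hP : IsTypeA p m P) (hm : m ≠ 0) (hA : IsCoatom A) {y : P}
    (hy : y ∉ A) : y ^ p ^ (m - 1) = 1 := by
  obtain ⟨M, hM, hyM⟩ := exists_isCoatom_mem hP.nonabelian y
  exact hP.pow_eq_one_of_mem_isCoatom hm hA hM (fun h => hy (h ▸ hyM)) hyM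

theorem IsTypeA.exists_surjective (hP : IsTypeA p m P) (hm : 2 ≤ m) :
    ∃ f : U p m ⧸ D p m →* P, Function.Surjective f := by
  obtain ⟨A, hA, hAc⟩ := hP.typeA.exists
  have hm0 : m ≠ 0 := by omega
  have := normal_of_isCoatom hP.isPGroup hA
  obtain ⟨x, hx⟩ := hP.exists_pow_ne_one hm0
  have hxA : x ∈ A := not_imp_comm.1 (hP.pow_eq_one_of_notMem hm0 hA) hx
  obtain ⟨b, -, hb⟩ := SetLike.exists_of_lt hA.lt_top
  have hbx : b * x ∉ A := fun h => hb ((A.mul_mem_cancel_right hxA).1 h)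
  obtain ⟨N, hN, hbN⟩ := exists_isCoatom_mem hP.nonabelian b
  have hcomm : (b⁻¹ * x * b * x⁻¹) ^ p ^ (m - 1) = 1 := by
    refine hP.pow_eq_one_of_mem_isCoatom hm0 hA hN (fun h => hb (h ▸ hbN)) ?_
    simpa [commutatorElement_def] using commutator_mem_of_isCoatom hP.isPGroup hN b⁻¹ x
  obtain ⟨F, hFb, hFx⟩ := exists_monoidHom_quotient p hm hxA (pow_mem_of_isCoatom hP.isPGroup hA b)
    (hP.exponent_eq ▸ Monoid.pow_exponent_eq_one x) (hP.pow_eq_one_of_notMem hm0 hA hb) hcomm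
    (hP.pow_eq_one_of_notMem hm0 hA hbx)
  refine ⟨F, MonoidHom.range_eq_top.1 (of_not_not fun hF => ?_)⟩
  obtain ⟨M, hM, hFM⟩ := (eq_top_or_exists_le_coatom F.range).resolve_left hF
  have hMA : M ≠ A := fun h => hb (h ▸ hFM ⟨_, hFb⟩)
  exact hx (hP.pow_eq_one_of_mem_isCoatom hm0 hA hM hMA (hFM ⟨_, hFx⟩))

end TypeA

section Quotient

variable (p m : ℕ) [hp : Fact p.Prime]

/-- The homomorphism `W → U / D`. -/
noncomputable def iotaQ : W p m →* U p m ⧸ D p m :=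
  (QuotientGroup.mk' (D p m)).comp SemidirectProduct.inl

/-- The image of `b₀` in `U / D`. -/
noncomputable def betaQ : U p m ⧸ D p m := QuotientGroup.mk' (D p m) (bU p m)

theorem iotaQ_eq_one_iff (v : AddW p m) :
    iotaQ p m (.ofAdd v) = 1 ↔ v ∈ AddSubgroup.zmultiples (dW p m) := by
  rw [iotaQ, MonoidHom.comp_apply, QuotientGroup.mk'_apply, QuotientGroup.eq_one_iff, D,
    dU_eq_inl_dW, Subgroup.mem_zpowers_iff, AddSubgroup.mem_zmultiples_iff]
  refine exists_congr fun k => ?_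
  rw [← map_zpow, SemidirectProduct.inl_inj, ← ofAdd_zsmul]
  exact Multiplicative.ofAdd.injective.eq_iff

theorem exists_eq_iotaQ_mul_betaQ_pow (q : U p m ⧸ D p m) :
    ∃ (w : W p m) (n : ℕ), q = iotaQ p m w * betaQ p m ^ n := by
  obtain ⟨u, rfl⟩ := QuotientGroup.mk'_surjective (D p m) q
  obtain ⟨w, n, rfl⟩ := exists_eq_inl_mul_bU_pow p m u
  exact ⟨w, n, rfl⟩

theorem betaQ_pow_prime_mem_center : betaQ p m ^ p ∈ Subgroup.center (U p m ⧸ D p m) := by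
  refine Subgroup.mem_center_iff.2 fun q => ?_
  obtain ⟨w, n, rfl⟩ := exists_eq_iotaQ_mul_betaQ_pow p m q
  have hw : Commute (betaQ p m ^ p) (iotaQ p m w) :=
    (commute_bU_pow_prime p m w).map (QuotientGroup.mk' (D p m))
  exact (hw.mul_right (Commute.pow_pow_self _ _ _)).symm

theorem iotaQ_phiEnd_sub_one (v : AddW p m) :
    iotaQ p m (.ofAdd ((phiEnd p m - 1) v)) = ⁅(betaQ p m)⁻¹, iotaQ p m (.ofAdd v)⁆ := by
  have hconj : (betaQ p m)⁻¹ * iotaQ p m (.ofAdd v) * betaQ p m =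
      iotaQ p m (.ofAdd (phiEnd p m v)) :=
    congrArg (QuotientGroup.mk' (D p m)) (bU_inv_mul_mul p m (.ofAdd v))
  rw [end_sub_apply, end_one_apply, ofAdd_sub, map_div, ← hconj, commutatorElement_def, inv_inv,
    div_eq_mul_inv]

theorem commute_betaQ_iotaQ_iff (v : AddW p m) :
    Commute (betaQ p m) (iotaQ p m (.ofAdd v)) ↔
      (phiEnd p m - 1) v ∈ AddSubgroup.zmultiples (dW p m) := by
  rw [← iotaQ_eq_one_iff, iotaQ_phiEnd_sub_one, commutatorElement_eq_one_iff_commute,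
    Commute.inv_left_iff]

variable {m} in
theorem not_commute_betaQ_iotaQ_aN_zero (hm : 2 ≤ m) :
    ¬ Commute (betaQ p m) (iotaQ p m (.ofAdd (aN p m 0))) := by
  rw [commute_betaQ_iotaQ_iff, phiEnd_aN_of_lt p m 0 hp.out.one_lt]
  exact aN_notMem_zmultiples_dW p hm hp.out.one_lt one_ne_zero

theorem mul_zpow_betaQ_pow_prime_pow (q : U p m ⧸ D p m) (z : ℤ) :
    (q * (betaQ p m ^ p) ^ z) ^ p ^ (m - 1) = q ^ p ^ (m - 1) := by
  have hz : Commute q ((betaQ p m ^ p) ^ z) :=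
    Subgroup.mem_center_iff.1 (zpow_mem (betaQ_pow_prime_mem_center p m) z) q
  have hβ : betaQ p m ^ p ^ (m - 1) = 1 :=
    congrArg (QuotientGroup.mk' (D p m)) (bU_pow_eq_one p m)
  rw [hz.mul_pow, ← zpow_natCast ((betaQ p m ^ p) ^ z), zpow_comm, zpow_natCast, pow_right_comm,
    hβ, one_pow, one_zpow, mul_one]

variable {m} in
theorem betaQ_mul_iotaQ_pow (hm : 2 ≤ m) (w : AddW p m) :
    (betaQ p m * iotaQ p m (.ofAdd w)) ^ p ^ (m - 1) = 1 :=
  (congrArg (QuotientGroup.mk' (D p m)) (bU_mul_inl_pow p hm w)).trans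
    ((iotaQ_eq_one_iff p m _).2 (pow_nsmul_normEnd_mem p hm w))

variable {m} in
theorem card_quotient (hm : 2 ≤ m) : Nat.card (U p m ⧸ D p m) = p ^ ((m - 1) * (p + 1)) := by
  have hD : Nat.card (D p m) = p := by
    rw [D, Nat.card_zpowers, dU_eq_inl_dW, orderOf_injective _ SemidirectProduct.inl_injective,
      orderOf_ofAdd_eq_addOrderOf, addOrderOf_dW p hm]
  have hU : Nat.card (U p m) = p ^ ((m - 1) * (p + 1)) * p := by
    have hW : Nat.card (W p m) = p ^ m * (p ^ (m - 1)) ^ (p - 1) := card_addW p m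
    have hB : Nat.card (B p m) = p ^ (m - 1) := Nat.card_zmod _
    obtain ⟨q, hq⟩ := Nat.exists_eq_succ_of_ne_zero hp.out.ne_zero
    obtain ⟨n, rfl⟩ := Nat.exists_eq_add_of_le' (one_le_two.trans hm)
    rw [SemidirectProduct.card, hW, hB, ← pow_mul, ← pow_add, ← pow_add, ← pow_succ]
    congr 1
    rw [hq]
    simp only [Nat.succ_eq_add_one, Nat.add_sub_cancel]
    ring
  refine Nat.eq_of_mul_eq_mul_right hp.out.pos ?_
  rw [← hU, (D p m).card_eq_card_quotient_mul_card_subgroup, hD]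

variable {m} in
theorem isPGroup_quotient (hm : 2 ≤ m) : IsPGroup p (U p m ⧸ D p m) :=
  IsPGroup.of_card (card_quotient p hm)

/-- The abelian maximal subgroup of `U / D`, generated by the images of `W` and of `b₀ ^ p`. -/
noncomputable def abelianQ : Subgroup (U p m ⧸ D p m) :=
  (MonoidHom.noncommCoprod (iotaQ p m) (zpowersHom _ (betaQ p m ^ p)) fun _ n =>
    Subgroup.mem_center_iff.1 (zpow_mem (betaQ_pow_prime_mem_center p m) n.toAdd) _).range

instance : IsMulCommutative (abelianQ p m) := Subgroup.range_isMulCommutative _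

theorem mem_abelianQ_iff {q : U p m ⧸ D p m} :
    q ∈ abelianQ p m ↔
      ∃ (w : AddW p m) (z : ℤ), q = iotaQ p m (.ofAdd w) * (betaQ p m ^ p) ^ z := by
  constructor
  · rintro ⟨⟨w, z⟩, rfl⟩
    exact ⟨w.toAdd, z.toAdd, rfl⟩
  · rintro ⟨w, z, rfl⟩
    exact ⟨(.ofAdd w, .ofAdd z), rfl⟩

theorem iotaQ_mem_abelianQ (w : W p m) : iotaQ p m w ∈ abelianQ p m :=
  (mem_abelianQ_iff p m).2 ⟨w.toAdd, 0, by simp⟩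

variable {m} in
theorem betaQ_notMem_abelianQ (hm : 2 ≤ m) : betaQ p m ∉ abelianQ p m := fun h =>
  not_commute_betaQ_iotaQ_aN_zero p hm (setLike_mul_comm h (iotaQ_mem_abelianQ p m _))

variable {m} in
theorem isCoatom_abelianQ (hm : 2 ≤ m) : IsCoatom (abelianQ p m) := by
  refine ⟨fun h => betaQ_notMem_abelianQ p hm (h ▸ Subgroup.mem_top _),
    fun M hM => eq_top_iff.2 fun q _ => ?_⟩
  have hιM (w : W p m) : iotaQ p m w ∈ M := hM.le (iotaQ_mem_abelianQ p m w)
  have hβpM : betaQ p m ^ p ∈ M := hM.le ((mem_abelianQ_iff p m).2 ⟨0, 1, by simp⟩)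
  have hβM : betaQ p m ∈ M := by
    obtain ⟨y, hyM, hy⟩ := SetLike.exists_of_lt hM
    obtain ⟨w, n, rfl⟩ := exists_eq_iotaQ_mul_betaQ_pow p m y
    have hpn : ¬ p ∣ n := by
      rintro ⟨c, rfl⟩
      exact hy ((mem_abelianQ_iff p m).2 ⟨w.toAdd, c, by rw [zpow_natCast, ← pow_mul, ofAdd_toAdd]⟩)
    exact mem_of_pow_mem_of_coprime ((Nat.Prime.coprime_iff_not_dvd hp.out).2 hpn) hβpM
      ((M.mul_mem_cancel_left (hιM w)).1 hyM)
  obtain ⟨w, n, rfl⟩ := exists_eq_iotaQ_mul_betaQ_pow p m q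
  exact M.mul_mem (hιM w) (M.pow_mem hβM n)

variable {m} in
theorem pow_eq_one_of_notMem_abelianQ (hm : 2 ≤ m) {y : U p m ⧸ D p m} (hy : y ∉ abelianQ p m) :
    y ^ p ^ (m - 1) = 1 := by
  refine pow_eq_one_of_notMem_isCoatom (isPGroup_quotient p hm) (isCoatom_abelianQ p hm)
    (betaQ_notMem_abelianQ p hm) (fun x hx => ?_) hy
  obtain ⟨w, z, rfl⟩ := (mem_abelianQ_iff p m).1 hx
  rw [← mul_assoc, mul_zpow_betaQ_pow_prime_pow p m, betaQ_mul_iotaQ_pow p hm]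

variable {m} in
theorem abelianQ_le_of_mem_of_pow_ne_one (hm : 2 ≤ m) {M : Subgroup (U p m ⧸ D p m)}
    (hM : IsCoatom M) {x : U p m ⧸ D p m} (hxM : x ∈ M) (hxA : x ∈ abelianQ p m)
    (hx : x ^ p ^ (m - 1) ≠ 1) : abelianQ p m ≤ M := by
  have hG := isPGroup_quotient p hm
  have hβpM := pow_mem_of_isCoatom hG hM (betaQ p m)
  have hφM (v : AddW p m) : iotaQ p m (.ofAdd ((phiEnd p m - 1) v)) ∈ M :=
    iotaQ_phiEnd_sub_one p m v ▸ commutator_mem_of_isCoatom hG hM _ _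
  have hιM (k : ℕ) (u : AddW p m) : iotaQ p m (.ofAdd (k • aN p m 0 + (phiEnd p m - 1) u)) ∈ M ↔
      iotaQ p m (.ofAdd (aN p m 0)) ^ k ∈ M := by
    rw [ofAdd_add, map_mul, M.mul_mem_cancel_right (hφM u), ofAdd_nsmul, map_pow]
  obtain ⟨w, z, rfl⟩ := (mem_abelianQ_iff p m).1 hxA
  obtain ⟨k, u, rfl⟩ := exists_eq_nsmul_aN_zero_add p m w
  have hpk : ¬ p ∣ k := by
    rintro ⟨c, rfl⟩
    have hpm : p ^ (m - 1) * (p * c) = c * p ^ m := by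
      rw [← mul_assoc, ← pow_succ, Nat.sub_add_cancel (by omega), mul_comm]
    refine hx ?_
    rw [mul_zpow_betaQ_pow_prime_pow p m, ← map_pow, ← ofAdd_nsmul, smul_add,
      pow_pred_nsmul_phiEnd_sub_one, add_zero, smul_smul, hpm, mul_smul, pow_nsmul_aN, smul_zero,
      ofAdd_zero, map_one]
  have ha : iotaQ p m (.ofAdd (aN p m 0)) ∈ M :=
    mem_of_pow_mem_of_coprime ((Nat.Prime.coprime_iff_not_dvd hp.out).2 hpk)
      (pow_mem_of_isCoatom hG hM _)
      ((hιM k u).1 ((M.mul_mem_cancel_right (M.zpow_mem hβpM z)).1 hxM))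
  intro y hy
  obtain ⟨w', z', rfl⟩ := (mem_abelianQ_iff p m).1 hy
  obtain ⟨k', u', rfl⟩ := exists_eq_nsmul_aN_zero_add p m w'
  exact M.mul_mem ((hιM k' u').2 (M.pow_mem ha k')) (M.zpow_mem hβpM z')

variable {m} in
theorem exponent_quotient (hm : 2 ≤ m) : Monoid.exponent (U p m ⧸ D p m) = p ^ m := by
  obtain ⟨n, rfl⟩ := Nat.exists_eq_add_of_le' (one_le_two.trans hm)
  have hpow (q : U p (n + 1) ⧸ D p (n + 1)) : q ^ p ^ (n + 1) = 1 := by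
    rw [pow_succ, pow_mul]
    by_cases hq : q ∈ abelianQ p (n + 1)
    · obtain ⟨w, z, rfl⟩ := (mem_abelianQ_iff p _).1 hq
      have hι : (iotaQ p (n + 1) (.ofAdd w) * (betaQ p (n + 1) ^ p) ^ z) ^ p ^ n =
          iotaQ p (n + 1) (.ofAdd w) ^ p ^ n :=
        mul_zpow_betaQ_pow_prime_pow p (n + 1) _ z
      rw [hι, ← pow_mul, ← pow_succ, ← map_pow, ← ofAdd_nsmul, pow_nsmul_eq_zero, ofAdd_zero,
        map_one]
    · have hq1 : q ^ p ^ n = 1 := pow_eq_one_of_notMem_abelianQ p hm hq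
      rw [hq1, one_pow]
  have ha : ¬ iotaQ p (n + 1) (.ofAdd (aN p _ 0)) ^ p ^ n = 1 := by
    rw [← map_pow, ← ofAdd_nsmul, iotaQ_eq_one_iff]
    exact pow_nsmul_aN_zero_notMem p hm
  exact Nat.dvd_antisymm (Monoid.exponent_dvd_of_forall_pow_eq_one hpow)
    (orderOf_eq_prime_pow ha (hpow _) ▸ Monoid.order_dvd_exponent _)

variable {m} in
theorem isExponentCritical_quotient (hm : 2 ≤ m) : IsExponentCritical (U p m ⧸ D p m) := by
  rw [isExponentCritical_iff_of_exponent_eq (by omega) (exponent_quotient p hm)]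
  intro M hM hMc x hxM
  by_contra hx
  have hxA : x ∈ abelianQ p m := not_imp_comm.1 (pow_eq_one_of_notMem_abelianQ p hm) hx
  have hAM := abelianQ_le_of_mem_of_pow_ne_one p hm hM hxM hxA hx
  rcases (isCoatom_abelianQ p hm).le_iff.1 hAM with rfl | rfl
  · exact hM.1 rfl
  · exact hMc inferInstance

variable {m} in
theorem hasUniqueAbelianMaximal_quotient (hm : 2 ≤ m) (hpm : p ≠ 2 ∨ 3 ≤ m) :
    HasUniqueAbelianMaximal (U p m ⧸ D p m) := by
  refine ⟨abelianQ p m, ⟨isCoatom_abelianQ p hm, inferInstance⟩, ?_⟩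
  rintro M ⟨hM, hMc⟩
  by_contra hne
  have hcentral : iotaQ p m (.ofAdd (aN p m 1)) ∈ Subgroup.center (U p m ⧸ D p m) := by
    rw [← phiEnd_aN_of_lt p m 0 hp.out.one_lt, iotaQ_phiEnd_sub_one]
    exact commutator_le_center_of_isCoatom (isPGroup_quotient p hm) hM (isCoatom_abelianQ p hm) hne
      (Subgroup.commutator_mem_commutator (Subgroup.mem_top _) (Subgroup.mem_top _))
  exact phiEnd_sub_one_aN_one_notMem p hm hpm
    ((commute_betaQ_iotaQ_iff p m _).1 (Subgroup.mem_center_iff.1 hcentral _))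

variable {m} in
theorem isTypeA_quotient (hm : 2 ≤ m) (hpm : p ≠ 2 ∨ 3 ≤ m) : IsTypeA p m (U p m ⧸ D p m) where
  isPGroup := isPGroup_quotient p hm
  nonabelian _ := not_commute_betaQ_iotaQ_aN_zero p hm (mul_comm' _ _)
  exponentCritical := isExponentCritical_quotient p hm
  exponent_eq := exponent_quotient p hm
  typeA := hasUniqueAbelianMaximal_quotient p hm hpm

end Quotient

end ExpCrit

theorem mainTheorem8 (p : ℕ) [Fact p.Prime] (m : ℕ) (hm : 2 ≤ m) (hpm : p ≠ 2 ∨ 3 ≤ m) :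
    ExpCrit.IsTypeA p m (ExpCrit.U p m ⧸ ExpCrit.D p m) ∧
    Nat.card (ExpCrit.U p m ⧸ ExpCrit.D p m) = p ^ ((m - 1) * (p + 1)) ∧
    ∀ (P : Type*) [Group P] [Finite P], ExpCrit.IsTypeA p m P →
      (∃ f : (ExpCrit.U p m ⧸ ExpCrit.D p m) →* P, Function.Surjective f) ∧
      Nat.card P ≤ Nat.card (ExpCrit.U p m ⧸ ExpCrit.D p m) ∧
      (Nat.card P = Nat.card (ExpCrit.U p m ⧸ ExpCrit.D p m) →
        Nonempty (P ≃* (ExpCrit.U p m ⧸ ExpCrit.D p m))) := by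
  refine ⟨ExpCrit.isTypeA_quotient p hm hpm, ExpCrit.card_quotient p hm, fun P _ _ hP => ?_⟩
  obtain ⟨f, hf⟩ := hP.exists_surjective hm
  refine ⟨⟨f, hf⟩, Nat.card_le_card_of_surjective f hf, fun hcard => ?_⟩
  have hbij : Function.Bijective f := (Nat.bijective_iff_surjective_and_card f).2 ⟨hf, hcard.symm⟩
  exact ⟨(MulEquiv.ofBijective f hbij).symm⟩
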